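/- Let $A$ be an associative ring with unit and let $\mathcal C$ be an $A$-coring, i.e. an $(A,A)$-bimodule with a coassociative $(A,A)$-bimodule map $\Delta:\mathcal C\to\mathcal C\otimes_A\mathcal C$, $\Delta(c)=\sum c_{(1)}\otimes c_{(2)}$, and a counit $\varepsilon:\mathcal C\to A$. Let $\gamma:\mathcal C\otimes_A\mathcal C\to A$ be a cointegral in $\mathcal C$, i.e. an $(A,A)$-bimodule map such that for all $c,c'\in\mathcal C$ $$\sum\gamma(c\otimes c'_{(1)})c'_{(2)}=\sum c_{(1)}\gamma(c_{(2)}\otimes c'),\qquad \sum\gamma(c_{(1)}\otimes c_{(2)})=\varepsilon(c)$$ (so $\mathcal C$ is coseparable), and let $g\in\mathcal C$ be grouplike, i.e. $\Delta(g)=g\otimes g$ and $\varepsilon(g)=1$. View $\mathcal C$ as a (non-unital) $A$-ring with the associative product $cc'=\sum c_{(1)}\gamma(c_{(2)}\otimes c')$. A right $\mathcal C$-module is a right $A$-module $M$ with an associative right $A$-linear action $M\otimes_A\mathcal C\to M$; it is firm if the induced map from $M\otimes_{\mathcal C}\mathcal C$, the quotient of $M\otimes_A\mathcal C$ by all $m\cdot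 c\otimes c'-m\otimes cc'$, to $M$ is bijective. Let $\mathbf M_{\mathcal C}$ be the category of firm right $\mathcal C$-modules and, for a right $\mathcal C$-module $M$, put $$M^{\mathcal C}_{g,\gamma}=\{m\in M\mid \forall c\in\mathcal C,\ m\cdot c=m\,\gamma(g\otimes c)\}.$$ Regard $A$ as a right $\mathcal C$-module by $a\cdot c=\gamma(ga\otimes c)$. Let $$B=A^{\mathcal C}_{g,\gamma}=\{b\in A\mid\forall c\in\mathcal C,\ \gamma(gb\otimes c)=b\gamma(g\otimes c)\},$$ a subring of $A$, and let $Q=\mathcal C^{\mathcal C}_{g,\gamma}$, a left ideal of $\mathcal C$ and a $(\mathcal C,B)$-bimodule. Let $\mathbf M_B$ be the category of right $B$-modules. Then: (1) $Q$ is a subring of $\mathcal C$ with right unit $g$: it is closed under the ring operations of $\mathcal C$, $g\in Q$, and $qg=q$ for all $q\in Q$. (2) The functor $-\otimes_BA:\mathbf M_B\to\mathbf M_{\mathcal C}$, where $(n\otimes a)\cdot c=n\otimes\gamma(ga\otimes c)$, is fully faithful; it is left adjoint to $(-)^{\mathcal C}_{g,\gamma}:\mathbf M_{\mathcal C}\to\mathbf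 M_B$, with unit $\eta_N:N\to(N\otimes_BA)^{\mathcal C}_{g,\gamma}$, $n\mapsto n\otimes 1_A$, and $\eta$ is an isomorphism. (3) $A$ as a right $\mathcal C$-module, and $Q$ as a left $\mathcal C$-module, are each isomorphic to a direct summand of $\mathcal C^n$ for some finite $n\in\mathbb N$. (4) $A$ is a generator as a left $B$-module, and $Q$ is a generator as a right $B$-module. -/

import Mathlib

open MulOpposite CategoryTheory
open scoped TensorProduct

/-!
Right modules over a ring `A` are modules over `Aᵐᵒᵖ`, so `op a • m` is the product `m a`.
-/

namespace CoringMorita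

/-! ### Tensor products over a noncommutative ring -/

section BTensor

/-- The subgroup of `M ⊗[ℤ] N` generated by all `m a ⊗ n - m ⊗ a n`. -/
def balancedRel (A : Type*) [Ring A] (M N : Type*) [AddCommGroup M] [Module Aᵐᵒᵖ M]
    [AddCommGroup N] [Module A N] : AddSubgroup (M ⊗[ℤ] N) :=
  AddSubgroup.closure
    {t | ∃ (m : M) (a : A) (n : N), t = (op a • m) ⊗ₜ[ℤ] n - m ⊗ₜ[ℤ] (a • n)}

/-- The tensor product `M ⊗_A N` of a right `A`-module `M` and a left `A`-module `N` over
an arbitrary ring `A`. -/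
def BTensor (A : Type*) [Ring A] (M N : Type*) [AddCommGroup M] [Module Aᵐᵒᵖ M]
    [AddCommGroup N] [Module A N] : Type _ :=
  (M ⊗[ℤ] N) ⧸ balancedRel A M N

namespace BTensor

variable {A : Type*} [Ring A] {M N P M' N' P' : Type*}
  [AddCommGroup M] [Module Aᵐᵒᵖ M] [AddCommGroup N] [Module A N] [AddCommGroup P]
  [AddCommGroup M'] [Module Aᵐᵒᵖ M'] [AddCommGroup N'] [Module A N']

instance : AddCommGroup (BTensor A M N) :=
  inferInstanceAs (AddCommGroup ((M ⊗[ℤ] N) ⧸ balancedRel A M N))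

variable (A) in
/-- The pure tensor `m ⊗ n` in `M ⊗_A N`. -/
def tmul (m : M) (n : N) : BTensor A M N :=
  QuotientAddGroup.mk (s := balancedRel A M N) (m ⊗ₜ[ℤ] n)

theorem add_tmul (m m' : M) (n : N) : tmul A (m + m') n = tmul A m n + tmul A m' n := by
  unfold tmul; rw [TensorProduct.add_tmul]; rfl

theorem tmul_add (m : M) (n n' : N) : tmul A m (n + n') = tmul A m n + tmul A m n' := by
  unfold tmul; rw [TensorProduct.tmul_add]; rfl

theorem op_smul_tmul (m : M) (a : A) (n : N) : tmul A (op a • m) n = tmul A m (a • n) := by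
  refine (QuotientAddGroup.eq_iff_sub_mem).2 (AddSubgroup.subset_closure ⟨m, a, n, rfl⟩)

@[elab_as_elim]
theorem induction_on {p : BTensor A M N → Prop} (t : BTensor A M N)
    (tmul : ∀ m n, p (tmul A m n)) (add : ∀ x y, p x → p y → p (x + y)) (zero : p 0) : p t := by
  induction t using QuotientAddGroup.induction_on with
  | H z =>
    induction z using TensorProduct.induction_on with
    | zero => exact zero
    | tmul m n => exact tmul m n
    | add x y hx hy => exact add _ _ hx hy

/-- The universal property: a biadditive `A`-balanced map induces an additive map on the
tensor product. -/
def lift (f : M →+ N →+ P) (h : ∀ (m : M) (a : A) (n : N), f (op a • m) n = f m (a • n)) :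
    BTensor A M N →+ P :=
  QuotientAddGroup.lift (balancedRel A M N)
    (TensorProduct.liftAddHom f (fun r m n => by simp)) (by
      refine (AddSubgroup.closure_le _).2 ?_
      rintro _ ⟨m, a, n, rfl⟩
      simp [h])

@[simp] theorem lift_tmul (f : M →+ N →+ P) (h) (m : M) (n : N) :
    lift (A := A) f h (tmul A m n) = f m n := rfl

theorem hom_ext {f g : BTensor A M N →+ P} (h : ∀ m n, f (tmul A m n) = g (tmul A m n)) :
    f = g := by
  ext t
  induction t using induction_on with
  | tmul m n => exact h m n
  | add x y hx hy => rw [map_add, map_add, hx, hy]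
  | zero => rw [map_zero, map_zero]

variable (A M N) in
/-- The universal biadditive map `(m, n) ↦ m ⊗ n`. -/
def mk : M →+ N →+ BTensor A M N :=
  AddMonoidHom.mk' (fun m => AddMonoidHom.mk' (fun n => tmul A m n) (tmul_add m))
    (fun m m' => by ext n; exact add_tmul m m' n)

@[simp] theorem mk_apply (m : M) (n : N) : mk A M N m n = tmul A m n := rfl

theorem zero_tmul (n : N) : tmul A (0 : M) n = 0 := by
  rw [← mk_apply, map_zero, AddMonoidHom.zero_apply]

theorem tmul_zero (m : M) : tmul A m (0 : N) = 0 := by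
  rw [← mk_apply, map_zero]

/-- The map `f ⊗ g`. -/
def map (f : M →ₗ[Aᵐᵒᵖ] M') (g : N →ₗ[A] N') : BTensor A M N →+ BTensor A M' N' :=
  lift (AddMonoidHom.mk' (fun m => ((mk A M' N') (f m)).comp g.toAddMonoidHom)
    (fun m m' => by ext n; simp))
    (fun m a n => by simp [op_smul_tmul])

@[simp] theorem map_tmul (f : M →ₗ[Aᵐᵒᵖ] M') (g : N →ₗ[A] N') (m : M) (n : N) :
    map f g (tmul A m n) = tmul A (f m) (g n) := rfl

section Left

variable {R : Type*} [Ring R] [Module R M] [SMulCommClass R Aᵐᵒᵖ M]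

instance : SMul R (BTensor A M N) :=
  ⟨fun r => map (DistribSMul.toLinearMap Aᵐᵒᵖ M r) LinearMap.id⟩

/-- The left action `r (m ⊗ n) = (r m) ⊗ n`. -/
theorem smul_tmul (r : R) (m : M) (n : N) : r • tmul A m n = tmul A (r • m) n := rfl

instance : Module R (BTensor A M N) where
  smul_zero r := map_zero (map (DistribSMul.toLinearMap Aᵐᵒᵖ M r) LinearMap.id)
  smul_add r := map_add (map (DistribSMul.toLinearMap Aᵐᵒᵖ M r) LinearMap.id)
  one_smul t := DFunLike.congr_fun
    (f := map (DistribSMul.toLinearMap Aᵐᵒᵖ M (1 : R)) LinearMap.id)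
    (g := AddMonoidHom.id (BTensor A M N)) (hom_ext fun m n => by simp) t
  mul_smul r s t := DFunLike.congr_fun
    (f := map (DistribSMul.toLinearMap Aᵐᵒᵖ M (r * s)) LinearMap.id)
    (g := (map (DistribSMul.toLinearMap Aᵐᵒᵖ M r) LinearMap.id).comp
      (map (N := N) (DistribSMul.toLinearMap Aᵐᵒᵖ M s) LinearMap.id))
    (hom_ext fun m n => by simp [mul_smul]) t
  add_smul r s t := DFunLike.congr_fun
    (f := map (DistribSMul.toLinearMap Aᵐᵒᵖ M (r + s)) LinearMap.id)
    (g := map (DistribSMul.toLinearMap Aᵐᵒᵖ M r) LinearMap.id +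
      (map (N := N) (DistribSMul.toLinearMap Aᵐᵒᵖ M s) LinearMap.id))
    (hom_ext fun m n => by simp [add_smul, add_tmul]) t
  zero_smul t := DFunLike.congr_fun
    (f := map (DistribSMul.toLinearMap Aᵐᵒᵖ M (0 : R)) LinearMap.id)
    (g := (0 : BTensor A M N →+ BTensor A M N)) (hom_ext fun m n => by simp [zero_tmul]) t

end Left

section Right

variable {S : Type*} [Ring S] [Module Sᵐᵒᵖ N] [SMulCommClass A Sᵐᵒᵖ N]

variable (A N) in
/-- Right multiplication by a scalar, as a left linear map. -/
def rsmul (s : Sᵐᵒᵖ) : N →ₗ[A] N where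
  toFun n := s • n
  map_add' := smul_add s
  map_smul' a n := (smul_comm a s n).symm

@[simp] theorem rsmul_apply (s : Sᵐᵒᵖ) (n : N) : rsmul A N s n = s • n := rfl

instance : SMul Sᵐᵒᵖ (BTensor A M N) :=
  ⟨fun s => map LinearMap.id (rsmul A N s)⟩

/-- The right action `(m ⊗ n) s = m ⊗ (n s)`. -/
theorem smul_tmul_right (s : Sᵐᵒᵖ) (m : M) (n : N) : s • tmul A m n = tmul A m (s • n) := rfl

instance instModuleRight : Module Sᵐᵒᵖ (BTensor A M N) where
  smul_zero r := map_zero (map LinearMap.id (rsmul A N r))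
  smul_add r := map_add (map LinearMap.id (rsmul A N r))
  one_smul t := DFunLike.congr_fun
    (f := map LinearMap.id (rsmul A N (1 : Sᵐᵒᵖ)))
    (g := AddMonoidHom.id (BTensor A M N)) (hom_ext fun m n => by simp) t
  mul_smul r s t := DFunLike.congr_fun
    (f := map LinearMap.id (rsmul A N (r * s)))
    (g := (map LinearMap.id (rsmul A N r)).comp
      (map (M := M) LinearMap.id (rsmul A N s)))
    (hom_ext fun m n => by simp [mul_smul]) t
  add_smul r s t := DFunLike.congr_fun
    (f := map LinearMap.id (rsmul A N (r + s)))
    (g := map LinearMap.id (rsmul A N r) +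
      (map (M := M) LinearMap.id (rsmul A N s)))
    (hom_ext fun m n => by simp [add_smul, tmul_add]) t
  zero_smul t := DFunLike.congr_fun
    (f := map LinearMap.id (rsmul A N (0 : Sᵐᵒᵖ)))
    (g := (0 : BTensor A M N →+ BTensor A M N)) (hom_ext fun m n => by simp [tmul_zero]) t

end Right

section Assoc

variable [Module Aᵐᵒᵖ N] [SMulCommClass A Aᵐᵒᵖ N] [Module A P]

/-- The biadditive map `(m ⊗ n, p) ↦ m ⊗ (n ⊗ p)`. -/
def assocAux : BTensor A M N →+ P →+ BTensor A M (BTensor A N P) :=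
  lift (AddMonoidHom.mk' (fun m => AddMonoidHom.mk'
          (fun n => ((mk A M (BTensor A N P)) m).comp ((mk A N P) n))
          (fun n n' => by
            ext p
            exact (congrArg (tmul A m) (add_tmul n n' p)).trans (tmul_add _ _ _)))
        (fun m m' => by ext n p; exact add_tmul m m' _))
      (fun m a n => by
        ext p
        exact (op_smul_tmul m a _).trans (congrArg (tmul A m) (smul_tmul a n p)))

/-- The canonical map `(M ⊗_A N) ⊗_A P → M ⊗_A (N ⊗_A P)`, `(m ⊗ n) ⊗ p ↦ m ⊗ (n ⊗ p)`. -/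
def assoc : BTensor A (BTensor A M N) P →+ BTensor A M (BTensor A N P) :=
  lift assocAux (fun t a p => by
      induction t using induction_on with
      | tmul m n => exact congrArg (tmul A m) (op_smul_tmul n a p)
      | add x y hx hy =>
        have h : op a • (x + y) = op a • x + op a • y := smul_add _ _ _
        rw [h, map_add, map_add]
        exact congrArg₂ (· + ·) hx hy
      | zero =>
        have h : op a • (0 : BTensor A M N) = 0 := smul_zero _
        rw [h, map_zero]; rfl)

@[simp] theorem assoc_tmul (m : M) (n : N) (p : P) :
    assoc (tmul A (tmul A m n) p) = tmul A m (tmul A n p) := rfl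

end Assoc

end BTensor

end BTensor

/-- Additive maps that are left and right `A`-linear. -/
structure BimodHom (A : Type*) [Ring A] (M N : Type*) [AddCommGroup M] [Module A M]
    [Module Aᵐᵒᵖ M] [AddCommGroup N] [Module A N] [Module Aᵐᵒᵖ N] extends M →+ N where
  map_smul' : ∀ (a : A) (m : M), toFun (a • m) = a • toFun m
  map_op_smul' : ∀ (a : A) (m : M), toFun (op a • m) = op a • toFun m

namespace BimodHom

variable {A : Type*} [Ring A] {M N : Type*} [AddCommGroup M] [Module A M]
    [Module Aᵐᵒᵖ M] [AddCommGroup N] [Module A N] [Module Aᵐᵒᵖ N]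

instance : CoeFun (BimodHom A M N) (fun _ => M → N) := ⟨fun f => f.toAddMonoidHom⟩

/-- The underlying left linear map. -/
def leftLin (f : BimodHom A M N) : M →ₗ[A] N :=
  { f.toAddMonoidHom with map_smul' := f.map_smul' }

/-- The underlying right linear map. -/
def rightLin (f : BimodHom A M N) : M →ₗ[Aᵐᵒᵖ] N :=
  { f.toAddMonoidHom with map_smul' := fun a m => f.map_op_smul' a.unop m }

theorem map_add (f : BimodHom A M N) (x y : M) : f (x + y) = f x + f y := f.map_add' x y
theorem map_zero (f : BimodHom A M N) : f 0 = 0 := f.map_zero'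
theorem map_smul (f : BimodHom A M N) (a : A) (x : M) : f (a • x) = a • f x := f.map_smul' a x
theorem map_op_smul (f : BimodHom A M N) (a : A) (x : M) : f (op a • x) = op a • f x :=
  f.map_op_smul' a x
@[simp] theorem leftLin_apply (f : BimodHom A M N) (x : M) : f.leftLin x = f x := rfl
@[simp] theorem rightLin_apply (f : BimodHom A M N) (x : M) : f.rightLin x = f x := rfl

end BimodHom

/-! ### Corings, grouplike elements, cointegrals -/

section Coring

/-- The canonical map `A ⊗_A C → C`. -/
def lid (A : Type*) [Ring A] (C : Type*) [AddCommGroup C] [Module A C] : BTensor A A C →+ C :=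
  BTensor.lift (AddMonoidHom.mk' (fun a => AddMonoidHom.mk' (fun c => a • c) (smul_add a))
    (fun a b => by ext c; simp [add_smul])) (fun m a n => by simp [mul_smul])

/-- The canonical map `C ⊗_A A → C`. -/
def rid (A : Type*) [Ring A] (C : Type*) [AddCommGroup C] [Module Aᵐᵒᵖ C] :
    BTensor A C A →+ C :=
  BTensor.lift (AddMonoidHom.mk' (fun c => AddMonoidHom.mk' (fun a => op a • c)
      (fun a b => by simp [add_smul]))
    (fun a b => by ext c; simp)) (fun m a n => by simp [mul_smul])

variable (A : Type*) [Ring A] (C : Type*) [AddCommGroup C] [Module A C] [Module Aᵐᵒᵖ C]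
  [SMulCommClass A Aᵐᵒᵖ C]

/-- An `A`-coring structure (with counit) on the `(A, A)`-bimodule `C`. -/
structure Coring where
  comul : BimodHom A C (BTensor A C C)
  coassoc : ∀ c : C, BTensor.assoc (BTensor.map comul.rightLin LinearMap.id (comul c)) =
    BTensor.map LinearMap.id comul.leftLin (comul c)
  counit : BimodHom A C A
  counit_left : ∀ c : C, lid A C (BTensor.map counit.rightLin LinearMap.id (comul c)) = c
  counit_right : ∀ c : C, rid A C (BTensor.map LinearMap.id counit.leftLin (comul c)) = c

variable {A C}

/-- Grouplike elements: `Δ g = g ⊗ g` and `ε g = 1`. -/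
structure Coring.IsGrouplike (K : Coring A C) (g : C) : Prop where
  comul_eq : K.comul g = BTensor.tmul A g g
  counit_eq : K.counit g = 1

/-- For `γ : C ⊗_A C → A` and `c : C`, the map `x ⊗ y ↦ γ(c ⊗ x) y`. -/
def contractLeft (γ : BimodHom A (BTensor A C C) A) (c : C) : BTensor A C C →+ C :=
  BTensor.lift (AddMonoidHom.mk' (fun x => AddMonoidHom.mk'
      (fun y => γ (BTensor.tmul A c x) • y) (smul_add _))
    (fun a b => by ext c; simp [BTensor.tmul_add, BimodHom.map_add, add_smul]))
    (fun x a y => by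
      simp [← BTensor.smul_tmul_right, BimodHom.map_op_smul, mul_smul])

/-- For `γ : C ⊗_A C → A` and `c : C`, the map `x ⊗ y ↦ x γ(y ⊗ c)`. -/
def contractRight (γ : BimodHom A (BTensor A C C) A) (c : C) : BTensor A C C →+ C :=
  BTensor.lift (AddMonoidHom.mk' (fun x => AddMonoidHom.mk'
      (fun y => op (γ (BTensor.tmul A y c)) • x)
      (fun a b => by simp [BTensor.add_tmul, BimodHom.map_add, add_smul]))
    (fun a b => by ext c; simp))
    (fun x a y => by
      simp [← BTensor.smul_tmul, BimodHom.map_smul, mul_smul])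

@[simp] theorem contractLeft_tmul (γ : BimodHom A (BTensor A C C) A) (c x y : C) :
    contractLeft γ c (BTensor.tmul A x y) = γ (BTensor.tmul A c x) • y := rfl

@[simp] theorem contractRight_tmul (γ : BimodHom A (BTensor A C C) A) (c x y : C) :
    contractRight γ c (BTensor.tmul A x y) = op (γ (BTensor.tmul A y c)) • x := rfl

/-- A cointegral in the coring `K`: a bimodule map `γ : C ⊗_A C → A` with
`∑ γ(c ⊗ c'₁) c'₂ = ∑ c₁ γ(c₂ ⊗ c')` and `∑ γ(c₁ ⊗ c₂) = ε(c)`. A coring that admits a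
cointegral is coseparable, and conversely. -/
structure Cointegral (K : Coring A C) where
  toBimodHom : BimodHom A (BTensor A C C) A
  colinear : ∀ c c' : C,
    contractLeft toBimodHom c (K.comul c') = contractRight toBimodHom c' (K.comul c)
  normalized : ∀ c : C, toBimodHom (K.comul c) = K.counit c

end Coring

/-! ### `A`-rings and their modules -/

/-- An `A`-ring structure on the `(A, A)`-bimodule `S`: an associative (not necessarily unital)
product given by an `(A, A)`-bimodule map `S ⊗_A S → S`, here written as a biadditive
`A`-balanced map. -/
structure ARing (A : Type*) [Ring A] (S : Type*) [AddCommGroup S] [Module A S]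
    [Module Aᵐᵒᵖ S] where
  mul : S →+ S →+ S
  mul_balanced : ∀ (r : S) (a : A) (s : S), mul (op a • r) s = mul r (a • s)
  smul_mul : ∀ (a : A) (r s : S), mul (a • r) s = a • mul r s
  mul_op_smul : ∀ (a : A) (r s : S), mul r (op a • s) = op a • mul r s
  mul_assoc : ∀ r s t : S, mul (mul r s) t = mul r (mul s t)

namespace ARing

variable {A : Type*} [Ring A] {S : Type*} [AddCommGroup S] [Module A S] [Module Aᵐᵒᵖ S]

/-- Subrings of a non-unital ring. -/
structure IsSubring (R : ARing A S) (T : Set S) : Prop where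
  zero_mem : 0 ∈ T
  add_mem : ∀ s ∈ T, ∀ t ∈ T, s + t ∈ T
  neg_mem : ∀ s ∈ T, -s ∈ T
  mul_mem : ∀ s ∈ T, ∀ t ∈ T, R.mul s t ∈ T

/-- A right module structure over the `A`-ring `R` on the right `A`-module `M`: an associative
action given by a right `A`-linear map `M ⊗_A S → M`, written as a balanced biadditive map. -/
structure RightAction (R : ARing A S) (M : Type*) [AddCommGroup M] [Module Aᵐᵒᵖ M] where
  act : M →+ S →+ M
  act_balanced : ∀ (m : M) (a : A) (s : S), act (op a • m) s = act m (a • s)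
  act_op_smul : ∀ (a : A) (m : M) (s : S), act m (op a • s) = op a • act m s
  act_mul : ∀ (m : M) (s t : S), act (act m s) t = act m (R.mul s t)

/-- A left module structure over the `A`-ring `R` on the left `A`-module `M`. -/
structure LeftAction (R : ARing A S) (M : Type*) [AddCommGroup M] [Module A M] where
  act : S →+ M →+ M
  act_balanced : ∀ (s : S) (a : A) (m : M), act (op a • s) m = act s (a • m)
  smul_act : ∀ (a : A) (s : S) (m : M), act (a • s) m = a • act s m
  mul_act : ∀ (s t : S) (m : M), act (R.mul s t) m = act s (act t m)

variable {R : ARing A S}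

section RightAction

variable {M N : Type*} [AddCommGroup M] [Module Aᵐᵒᵖ M] [AddCommGroup N] [Module Aᵐᵒᵖ N]

/-- The right regular module. -/
def rightRegular (R : ARing A S) : R.RightAction S :=
  ⟨R.mul, R.mul_balanced, R.mul_op_smul, R.mul_assoc⟩

namespace RightAction

/-- The direct sum of `n` copies of a right module. -/
def pow (α : R.RightAction M) (n : ℕ) : R.RightAction (Fin n → M) where
  act := AddMonoidHom.mk' (fun m => AddMonoidHom.mk' (fun s i => α.act (m i) s)
      (fun s t => by ext i; simp)) (fun m m' => by ext s i; simp)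
  act_balanced m a s := by ext i; simp [α.act_balanced]
  act_op_smul a m s := by ext i; simp [α.act_op_smul]
  act_mul m s t := by ext i; simp [α.act_mul]

/-- Morphisms of right modules over an `A`-ring. -/
@[ext] structure Hom (α : R.RightAction M) (β : R.RightAction N) extends M →ₗ[Aᵐᵒᵖ] N where
  map_act' : ∀ (m : M) (s : S), toFun (α.act m s) = β.act (toFun m) s

/-- `M` is (isomorphic to) a direct summand of `N`. -/
def IsDirectSummand (α : R.RightAction M) (β : R.RightAction N) : Prop :=
  ∃ (i : Hom α β) (p : Hom β α), ∀ m : M, p.toLinearMap (i.toLinearMap m) = m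

/-- The subgroup of `M ⊗_A S` generated by all `m·s ⊗ t - m ⊗ st`. -/
def rel (α : R.RightAction M) : AddSubgroup (BTensor A M S) :=
  AddSubgroup.closure {x | ∃ (m : M) (s t : S),
    x = BTensor.tmul A (α.act m s) t - BTensor.tmul A m (R.mul s t)}

/-- The map `M ⊗_A S → M` of the action. -/
def actHom (α : R.RightAction M) : BTensor A M S →+ M := BTensor.lift α.act α.act_balanced

theorem rel_le_ker (α : R.RightAction M) : α.rel ≤ α.actHom.ker := by
  refine (AddSubgroup.closure_le _).2 ?_
  rintro _ ⟨m, s, t, rfl⟩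
  simp [AddMonoidHom.mem_ker, actHom, α.act_mul]

/-- The map `M ⊗_R R → M` induced by the action, where `M ⊗_R R` is the cokernel of
`M ⊗_A S ⊗_A S → M ⊗_A S`, `m ⊗ s ⊗ t ↦ m·s ⊗ t - m ⊗ st`. -/
def firmMap (α : R.RightAction M) : BTensor A M S ⧸ α.rel →+ M :=
  QuotientAddGroup.lift α.rel α.actHom α.rel_le_ker

/-- Firm modules: `M ⊗_R R → M` is an isomorphism. -/
def IsFirm (α : R.RightAction M) : Prop := Function.Bijective α.firmMap

end RightAction

end RightAction

section LeftAction

variable {M N : Type*} [AddCommGroup M] [Module A M] [AddCommGroup N] [Module A N]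

/-- The left regular module. -/
def leftRegular (R : ARing A S) : R.LeftAction S :=
  ⟨R.mul, R.mul_balanced, R.smul_mul, R.mul_assoc⟩

namespace LeftAction

/-- The direct sum of `n` copies of a left module. -/
def pow (α : R.LeftAction M) (n : ℕ) : R.LeftAction (Fin n → M) where
  act := AddMonoidHom.mk' (fun s => AddMonoidHom.mk' (fun m i => α.act s (m i))
      (fun s t => by ext i; simp)) (fun m m' => by ext s i; simp)
  act_balanced m a s := by ext i; simp [α.act_balanced]
  smul_act a m s := by ext i; simp [α.smul_act]
  mul_act m s t := by ext i; simp [α.mul_act]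

/-- Morphisms of left modules over an `A`-ring. -/
@[ext] structure Hom (α : R.LeftAction M) (β : R.LeftAction N) extends M →ₗ[A] N where
  map_act' : ∀ (s : S) (m : M), toFun (α.act s m) = β.act s (toFun m)

/-- `M` is (isomorphic to) a direct summand of `N`. -/
def IsDirectSummand (α : R.LeftAction M) (β : R.LeftAction N) : Prop :=
  ∃ (i : Hom α β) (p : Hom β α), ∀ m : M, p.toLinearMap (i.toLinearMap m) = m

end LeftAction

end LeftAction

/-- Objects of the category of firm right modules over the `A`-ring `R`. -/
structure FirmMod.{w, u, v} {A : Type u} [Ring A] {S : Type v} [AddCommGroup S] [Module A S]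
    [Module Aᵐᵒᵖ S] (R : ARing A S) where
  carrier : Type w
  [addCommGroup : AddCommGroup carrier]
  [module : Module Aᵐᵒᵖ carrier]
  action : R.RightAction carrier
  firm : action.IsFirm

attribute [instance] FirmMod.addCommGroup FirmMod.module

instance : Category (FirmMod R) where
  Hom M N := RightAction.Hom M.action N.action
  id M := ⟨LinearMap.id, fun _ _ => rfl⟩
  comp f g := ⟨g.toLinearMap.comp f.toLinearMap, fun m s => by
    have h1 := f.map_act' m s
    have h2 := g.map_act' (f.toLinearMap m) s
    simp only [AddHom.toFun_eq_coe, LinearMap.coe_toAddHom, LinearMap.comp_apply] at *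
    rw [h1, h2]⟩

end ARing

/-- A left `R`-module `P` is a generator if every two distinct maps `X → Y` of left
`R`-modules are distinguished by some map `P → X`. -/
def IsGenerator.{w, u, v} (R : Type u) [Ring R] (P : Type v) [AddCommGroup P] [Module R P] :
    Prop :=
  ∀ (X Y : Type w) [AddCommGroup X] [Module R X] [AddCommGroup Y] [Module R Y]
    (f g : X →ₗ[R] Y), (∀ h : P →ₗ[R] X, f.comp h = g.comp h) → f = g

/-! ### The ring structure of a coseparable coring, and the invariants -/

namespace Cointegral

variable {A : Type*} [Ring A] {C : Type*} [AddCommGroup C] [Module A C] [Module Aᵐᵒᵖ C]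
  [SMulCommClass A Aᵐᵒᵖ C] {K : Coring A C} (γ : Cointegral K)

/-- The value `γ(c ⊗ c')`. -/
def app (c c' : C) : A := γ.toBimodHom (BTensor.tmul A c c')

theorem app_add_left (c d c' : C) : γ.app (c + d) c' = γ.app c c' + γ.app d c' := by
  simp [app, BTensor.add_tmul, BimodHom.map_add]

theorem app_add_right (c c' d' : C) : γ.app c (c' + d') = γ.app c c' + γ.app c d' := by
  simp [app, BTensor.tmul_add, BimodHom.map_add]

theorem app_balanced (c : C) (a : A) (c' : C) : γ.app (op a • c) c' = γ.app c (a • c') := by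
  simp [app, BTensor.op_smul_tmul]

theorem app_smul (a : A) (c c' : C) : γ.app (a • c) c' = a * γ.app c c' := by
  simp [app, ← BTensor.smul_tmul, BimodHom.map_smul]

theorem app_op_smul (a : A) (c c' : C) : γ.app c (op a • c') = γ.app c c' * a := by
  simp [app, ← BTensor.smul_tmul_right, BimodHom.map_op_smul]

/-- The product `c c' = ∑ c₁ γ(c₂ ⊗ c')`. -/
def prod (c c' : C) : C := contractRight γ.toBimodHom c' (K.comul c)

theorem prod_eq (c c' : C) : γ.prod c c' = contractLeft γ.toBimodHom c (K.comul c') :=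
  (γ.colinear c c').symm

theorem contractRight_add (c d : C) (t : BTensor A C C) :
    contractRight γ.toBimodHom (c + d) t =
      contractRight γ.toBimodHom c t + contractRight γ.toBimodHom d t := by
  induction t using BTensor.induction_on with
  | tmul x y => simp [BTensor.tmul_add, add_smul]
  | add x y hx hy => rw [map_add, map_add, map_add, hx, hy]; abel
  | zero => simp

theorem contractRight_smul (a : A) (c : C) (t : BTensor A C C) :
    contractRight γ.toBimodHom c (a • t) = a • contractRight γ.toBimodHom c t := by
  induction t using BTensor.induction_on with
  | tmul x y => simp [BTensor.smul_tmul, smul_comm]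
  | add x y hx hy => rw [smul_add, map_add, map_add, smul_add, hx, hy]
  | zero => simp

theorem contractLeft_op_smul (a : A) (c : C) (t : BTensor A C C) :
    contractLeft γ.toBimodHom c (op a • t) = op a • contractLeft γ.toBimodHom c t := by
  induction t using BTensor.induction_on with
  | tmul x y => simp [BTensor.smul_tmul_right, smul_comm]
  | add x y hx hy => rw [smul_add, map_add, map_add, smul_add, hx, hy]
  | zero => simp

theorem contractRight_op_smul_left (a : A) (c : C) (t : BTensor A C C) :
    contractRight γ.toBimodHom c (op a • t) = contractRight γ.toBimodHom (a • c) t := by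
  induction t using BTensor.induction_on with
  | tmul x y => simp [BTensor.smul_tmul_right, BTensor.op_smul_tmul]
  | add x y hx hy => rw [smul_add, map_add, map_add, hx, hy]
  | zero => simp

/-- The map `x ⊗ (y ⊗ z) ↦ γ(c ⊗ x) y γ(z ⊗ c'')`. -/
def contractBoth (c c'' : C) : BTensor A C (BTensor A C C) →+ C :=
  BTensor.lift (AddMonoidHom.mk' (fun x => AddMonoidHom.mk'
      (fun t => γ.app c x • contractRight γ.toBimodHom c'' t)
      (fun s t => by simp))
    (fun x y => by ext t; simp [app_add_right, add_smul]))
    (fun x a t => by simp [app_op_smul, contractRight_smul, mul_smul])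

theorem prod_assoc (c c' c'' : C) : γ.prod (γ.prod c c') c'' = γ.prod c (γ.prod c' c'') := by
  have h1 : ∀ t : BTensor A C C, γ.prod (contractLeft γ.toBimodHom c t) c'' =
      γ.contractBoth c c'' (BTensor.map LinearMap.id K.comul.leftLin t) := by
    intro t
    induction t using BTensor.induction_on with
    | tmul x y =>
      simp [contractBoth, prod, BimodHom.map_smul, contractRight_smul, app]
    | add x y hx hy =>
      rw [map_add, map_add, map_add, ← hx, ← hy]
      simp [prod]
    | zero => simp [prod]
  have h3 : ∀ (t : BTensor A C C) (y : C),
      op (γ.app y c'') • contractLeft γ.toBimodHom c t =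
        γ.contractBoth c c'' (BTensor.assoc (BTensor.tmul A t y)) := by
    intro t y
    induction t using BTensor.induction_on with
    | tmul u v => simp [contractBoth, app, smul_comm]
    | add x z hx hy => rw [map_add, smul_add, hx, hy, BTensor.add_tmul, map_add, map_add]
    | zero => simp [BTensor.zero_tmul]
  have h2 : ∀ t : BTensor A C C, γ.prod c (contractRight γ.toBimodHom c'' t) =
      γ.contractBoth c c'' (BTensor.assoc (BTensor.map K.comul.rightLin LinearMap.id t)) := by
    intro t
    induction t using BTensor.induction_on with
    | tmul x y =>
      rw [BTensor.map_tmul, BimodHom.rightLin_apply, LinearMap.id_apply, ← h3,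
        contractRight_tmul, prod_eq, BimodHom.map_op_smul, contractLeft_op_smul]
      rfl
    | add x y hx hy =>
      rw [map_add, map_add, map_add, map_add, ← hx, ← hy]
      simp [prod_eq]
    | zero => simp [prod_eq]
  rw [γ.prod_eq c c', h1, ← K.coassoc, ← h2]
  rfl

/-- The `A`-ring structure on a coseparable coring given by a cointegral. -/
def aring : ARing A C where
  mul := AddMonoidHom.mk' (fun c => AddMonoidHom.mk' (fun c' => γ.prod c c')
      (fun x y => γ.contractRight_add x y _)) (fun x y => by ext z; simp [prod])
  mul_balanced r a s := by
    simp [prod, BimodHom.map_op_smul, contractRight_op_smul_left]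
  smul_mul a r s := by simp [prod, BimodHom.map_smul, contractRight_smul]
  mul_op_smul a r s := by
    simp [prod_eq, BimodHom.map_op_smul, contractLeft_op_smul]
  mul_assoc := γ.prod_assoc

theorem aring_mul (c c' : C) : γ.aring.mul c c' = γ.prod c c' := rfl

theorem counit_prod (c c' : C) : K.counit (γ.prod c c') = γ.app c c' := by
  have h : ∀ t : BTensor A C C, K.counit (contractRight γ.toBimodHom c' t) =
      γ.app (lid A C (BTensor.map K.counit.rightLin LinearMap.id t)) c' := by
    intro t
    induction t using BTensor.induction_on with
    | tmul x y =>
      simp only [contractRight_tmul, BTensor.map_tmul, BimodHom.map_op_smul]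
      exact (γ.app_smul _ _ _).symm
    | add x y hx hy => simp only [map_add, app_add_left, hx, hy]
    | zero => simp [app, BTensor.zero_tmul]
  rw [prod, h, K.counit_left]

theorem app_prod (c c' c'' : C) : γ.app (γ.prod c c') c'' = γ.app c (γ.prod c' c'') := by
  rw [← counit_prod, ← counit_prod, prod_assoc]

/-- `B = {b ∈ A | ∀ c, γ(g b ⊗ c) = b γ(g ⊗ c)}`. -/
def baseRing (g : C) : Subring A where
  carrier := {b | ∀ c : C, γ.app (op b • g) c = b * γ.app g c}
  one_mem' c := by simp
  mul_mem' {b b'} hb hb' c := by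
    rw [op_mul, mul_smul, app_balanced, app_balanced, ← app_balanced, hb, ← app_balanced, hb',
      mul_assoc]
  zero_mem' c := by simp [app, BTensor.zero_tmul]
  add_mem' {b b'} hb hb' c := by
    rw [MulOpposite.op_add, add_smul, app_add_left, hb, hb', add_mul]
  neg_mem' {b} hb c := by
    have h : γ.app (op (-b) • g) c + γ.app (op b • g) c = 0 := by
      rw [← app_add_left, ← add_smul, ← MulOpposite.op_add, neg_add_cancel]
      simp [app, BTensor.zero_tmul]
    rw [eq_neg_of_add_eq_zero_left h, hb c, neg_mul]

theorem mem_baseRing {g : C} {b : A} :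
    b ∈ γ.baseRing g ↔ ∀ c : C, γ.app (op b • g) c = b * γ.app g c := Iff.rfl

section Invariants

variable (g : C) {M : Type*} [AddCommGroup M] [Module Aᵐᵒᵖ M] (α : γ.aring.RightAction M)

/-- The invariants `{m ∈ M | ∀ c, m·c = m γ(g ⊗ c)}` of a right `C`-module `M`. -/
def inv : AddSubgroup M where
  carrier := {m | ∀ c : C, α.act m c = op (γ.app g c) • m}
  zero_mem' c := by simp
  add_mem' {m m'} hm hm' c := by rw [map_add, AddMonoidHom.add_apply, hm, hm', smul_add]
  neg_mem' {m} hm c := by rw [map_neg, AddMonoidHom.neg_apply, hm, smul_neg]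

variable {g α} in
theorem mem_inv {m : M} :
    m ∈ γ.inv g α ↔ ∀ c : C, α.act m c = op (γ.app g c) • m := Iff.rfl

/-- The right action of `B` on the invariants, the restriction of the right action of `A`. -/
instance : SMul (γ.baseRing g)ᵐᵒᵖ (γ.inv g α) where
  smul b m := ⟨op (b.unop : A) • (m : M), fun c => by
    rw [α.act_balanced, m.2, ← app_balanced, b.unop.2, op_mul, mul_smul]⟩

@[simp] theorem coe_op_smul_inv (b : (γ.baseRing g)ᵐᵒᵖ) (m : γ.inv g α) :
    ((b • m : γ.inv g α) : M) = op (b.unop : A) • (m : M) := rfl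

instance : Module (γ.baseRing g)ᵐᵒᵖ (γ.inv g α) where
  one_smul m := by ext; simp
  mul_smul b b' m := by ext; simp [mul_smul]
  smul_zero b := by ext; simp
  smul_add b m m' := by ext; simp
  add_smul b b' m := by ext; simp [add_smul]
  zero_smul m := by ext; simp

/-- `Q`, the invariants of the right regular module `C`. -/
abbrev idealQ : AddSubgroup C := γ.inv g γ.aring.rightRegular

instance : SMul A (γ.idealQ g) where
  smul a q := ⟨a • (q : C), fun c => by
    have h := q.2 c
    change γ.aring.mul _ _ = _ at h
    change γ.aring.mul _ _ = _
    rw [γ.aring.smul_mul, h, smul_comm]⟩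

@[simp] theorem coe_smul_idealQ (a : A) (q : γ.idealQ g) :
    ((a • q : γ.idealQ g) : C) = a • (q : C) := rfl

instance : Module A (γ.idealQ g) where
  one_smul m := by ext; simp
  mul_smul b b' m := by ext; simp [mul_smul]
  smul_zero b := by ext; simp
  smul_add b m m' := by ext; simp
  add_smul b b' m := by ext; simp [add_smul]
  zero_smul m := by ext; simp

/-- `Q` is a left ideal of `C`, hence a left `C`-module. -/
def leftQ : γ.aring.LeftAction (γ.idealQ g) where
  act := AddMonoidHom.mk' (fun c => AddMonoidHom.mk'
      (fun q => (⟨γ.aring.mul c q, fun c' => by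
        have h := q.2 c'
        change γ.aring.mul _ _ = _ at h
        change γ.aring.mul _ _ = _
        rw [γ.aring.mul_assoc, h, γ.aring.mul_op_smul]⟩ : γ.idealQ g))
      (fun q q' => by ext; simp)) (fun c c' => by ext q; simp)
  act_balanced c a q := by ext; simp [γ.aring.mul_balanced]
  smul_act a c q := by ext; simp [γ.aring.smul_mul]
  mul_act c c' q := by ext; simp [γ.aring.mul_assoc]

end Invariants

section Grouplike

variable {g : C} (hg : K.IsGrouplike g)

theorem app_grouplike (hg : K.IsGrouplike g) : γ.app g g = 1 := by
  have h := γ.normalized g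
  rwa [hg.comul_eq, hg.counit_eq] at h

theorem prod_grouplike (hg : K.IsGrouplike g) (a : A) (c : C) :
    γ.prod (op a • g) c = op (γ.app (op a • g) c) • g := by
  rw [prod, BimodHom.map_op_smul, hg.comul_eq, BTensor.smul_tmul_right]
  rfl

/-- The right `C`-module `A`, with `a·c = γ(g a ⊗ c)`. -/
def rightA : γ.aring.RightAction A where
  act := AddMonoidHom.mk' (fun a => AddMonoidHom.mk' (fun c => γ.app (op a • g) c)
      (fun c c' => γ.app_add_right _ c c'))
    (fun a b => by ext c; simp [add_smul, app_add_left])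
  act_balanced m a c := by
    simp [mul_smul, app_balanced]
  act_op_smul a m c := by simp [app_op_smul]
  act_mul a c c' := by
    change γ.app (op (γ.app (op a • g) c) • g) c' = γ.app (op a • g) (γ.prod c c')
    rw [← γ.prod_grouplike hg, app_prod]

theorem rightA_act (a : A) (c : C) : (γ.rightA hg).act a c = γ.app (op a • g) c := rfl

variable (N : Type*) [AddCommGroup N] [Module (γ.baseRing g)ᵐᵒᵖ N]

/-- The biadditive map `(n ⊗ a, c) ↦ n ⊗ (a·c)`. -/
def rightTensorAct : BTensor (γ.baseRing g) N A →+ C →+ BTensor (γ.baseRing g) N A :=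
  BTensor.lift (AddMonoidHom.mk' (fun n => AddMonoidHom.mk'
        (fun a => ((BTensor.mk (γ.baseRing g) N A) n).comp ((γ.rightA hg).act a))
        (fun a b => by ext c; simp [BTensor.tmul_add]))
      (fun n n' => by ext a c; exact BTensor.add_tmul n n' _))
    (fun n b a => by
      ext c
      have h : (γ.rightA hg).act (b • a) c = b • (γ.rightA hg).act a c := by
        rw [rightA_act, rightA_act, Subring.smul_def, smul_eq_mul, op_mul, mul_smul,
          app_balanced, b.2, Subring.smul_def, smul_eq_mul, app_balanced]
      exact (BTensor.op_smul_tmul n b _).trans (congrArg (BTensor.tmul _ n) h.symm))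

/-- The right `C`-module `N ⊗_B A`, with `(n ⊗ a)·c = n ⊗ (a·c)`. -/
def rightTensor : γ.aring.RightAction (BTensor (γ.baseRing g) N A) where
  act := γ.rightTensorAct hg N
  act_balanced t a c := by
    induction t using BTensor.induction_on with
    | tmul n x => exact congrArg (BTensor.tmul _ n) ((γ.rightA hg).act_balanced x a c)
    | add x y hx hy =>
      have h : op a • (x + y) = op a • x + op a • y := smul_add _ _ _
      rw [h, map_add, map_add]
      exact congrArg₂ (· + ·) hx hy
    | zero =>
      have h : op a • (0 : BTensor (γ.baseRing g) N A) = 0 := smul_zero _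
      rw [h, map_zero]; rfl
  act_op_smul a t c := by
    induction t using BTensor.induction_on with
    | tmul n x => exact congrArg (BTensor.tmul _ n) ((γ.rightA hg).act_op_smul a x c)
    | add x y hx hy =>
      rw [map_add]
      exact (congrArg₂ (· + ·) hx hy).trans (smul_add _ _ _).symm
    | zero =>
      rw [map_zero]
      exact (smul_zero (op a)).symm
  act_mul t c c' := by
    induction t using BTensor.induction_on with
    | tmul n x => exact congrArg (BTensor.tmul _ n) ((γ.rightA hg).act_mul x c c')
    | add x y hx hy =>
      rw [map_add, AddMonoidHom.add_apply, map_add]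
      exact congrArg₂ (· + ·) hx hy
    | zero =>
      rw [map_zero, AddMonoidHom.zero_apply, map_zero]; rfl

theorem rightTensor_act (n : N) (a : A) (c : C) :
    (γ.rightTensor hg N).act (BTensor.tmul _ n a) c =
      BTensor.tmul _ n (γ.app (op a • g) c) := rfl

theorem act_one_grouplike (n : N) (a : A) :
    (γ.rightTensor hg N).act (BTensor.tmul _ n 1) (op a • g) = BTensor.tmul _ n a := by
  rw [rightTensor_act, app_op_smul, op_one, one_smul, app_grouplike γ hg, one_mul]

theorem mk_act_tmul {M : Type*} [AddCommGroup M] [Module Aᵐᵒᵖ M]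
    (α : γ.aring.RightAction M) (m : M) (s t : C) :
    (QuotientAddGroup.mk (BTensor.tmul A (α.act m s) t) : BTensor A M C ⧸ α.rel) =
      QuotientAddGroup.mk (BTensor.tmul A m (γ.prod s t)) :=
  QuotientAddGroup.eq_iff_sub_mem.2 (AddSubgroup.subset_closure ⟨m, s, t, rfl⟩)

/-- The map `n ⊗ a ↦ (n ⊗ 1) ⊗ g a`, the inverse of `(N ⊗_B A) ⊗_C C → N ⊗_B A`. -/
def firmInv : BTensor (γ.baseRing g) N A →+
    BTensor A (BTensor (γ.baseRing g) N A) C ⧸ (γ.rightTensor hg N).rel :=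
  BTensor.lift (AddMonoidHom.mk' (fun n => AddMonoidHom.mk'
      (fun a => QuotientAddGroup.mk (BTensor.tmul A (BTensor.tmul _ n 1) (op a • g)))
      (fun a b => by rw [MulOpposite.op_add, add_smul, BTensor.tmul_add]; rfl))
    (fun n n' => by ext a; simp [BTensor.add_tmul]))
    (fun n b a => by
      change (QuotientAddGroup.mk _ : _ ⧸ (γ.rightTensor hg N).rel) = QuotientAddGroup.mk _
      rw [BTensor.op_smul_tmul, Subring.smul_def, smul_eq_mul, mul_one,
        ← γ.act_one_grouplike hg N n b, mk_act_tmul, prod_grouplike γ hg, b.2, app_op_smul,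
        app_grouplike γ hg, one_mul, Subring.smul_def, smul_eq_mul])

theorem rightTensor_firm : (γ.rightTensor hg N).IsFirm := by
  refine Function.bijective_iff_has_inverse.2 ⟨γ.firmInv hg N, ?_, ?_⟩
  · intro x
    induction x using QuotientAddGroup.induction_on with
    | H x =>
      change γ.firmInv hg N ((γ.rightTensor hg N).actHom x) = _
      induction x using BTensor.induction_on with
      | tmul t c =>
        change γ.firmInv hg N ((γ.rightTensor hg N).act t c) = _
        induction t using BTensor.induction_on with
        | tmul n a =>
          rw [← γ.act_one_grouplike hg N n a, mk_act_tmul, prod_grouplike γ hg,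
            γ.act_one_grouplike, rightTensor_act]
          rfl
        | add x y hx hy =>
          rw [map_add, AddMonoidHom.add_apply, map_add, hx, hy, BTensor.add_tmul]; rfl
        | zero => rw [map_zero, AddMonoidHom.zero_apply, map_zero, BTensor.zero_tmul]; rfl
      | add x y hx hy => rw [map_add, map_add, hx, hy]; rfl
      | zero => rw [map_zero, map_zero]; rfl
  · intro t
    induction t using BTensor.induction_on with
    | tmul n a => exact γ.act_one_grouplike hg N n a
    | add x y hx hy => rw [map_add, map_add, hx, hy]
    | zero => rw [map_zero, map_zero]

end Grouplike

end Cointegral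

/-! ### The functors -/

section Functors

universe w u v

variable {A : Type u} [Ring A] {C : Type v} [AddCommGroup C] [Module A C] [Module Aᵐᵒᵖ C]
  [SMulCommClass A Aᵐᵒᵖ C] {K : Coring A C} (γ : Cointegral K) {g : C}

/-- The functor `- ⊗_B A` from right `B`-modules to firm right `C`-modules. -/
def tensorFunctor (hg : K.IsGrouplike g) :
    ModuleCat.{max u w} (γ.baseRing g)ᵐᵒᵖ ⥤ ARing.FirmMod.{max u w} γ.aring where
  obj N := ⟨BTensor (γ.baseRing g) N A, γ.rightTensor hg N, γ.rightTensor_firm hg N⟩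
  map {N N'} f :=
    { BTensor.map f.hom (LinearMap.id : A →ₗ[γ.baseRing g] A) with
      map_smul' := fun a t => by
        change BTensor.map f.hom LinearMap.id _ = a • BTensor.map f.hom LinearMap.id _
        induction t using BTensor.induction_on with
        | tmul n x => rfl
        | add x y hx hy => rw [smul_add, map_add, map_add, hx, hy, smul_add]
        | zero => rw [smul_zero, map_zero, smul_zero]
      map_act' := fun t c => by
        change BTensor.map f.hom LinearMap.id _ =
          (γ.rightTensor hg N').act (BTensor.map f.hom LinearMap.id _) c
        induction t using BTensor.induction_on with
        | tmul n x => rfl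
        | add x y hx hy =>
          rw [map_add, AddMonoidHom.add_apply, map_add, hx, hy, map_add, map_add]; rfl
        | zero => rw [map_zero, AddMonoidHom.zero_apply, map_zero, map_zero]; rfl }
  map_id N := by
    apply ARing.RightAction.Hom.ext
    ext t
    change BTensor.map _ _ t = t
    induction t using BTensor.induction_on with
    | tmul n x => rfl
    | add x y hx hy => rw [map_add, hx, hy]
    | zero => rw [map_zero]
  map_comp {N N' N''} f f' := by
    apply ARing.RightAction.Hom.ext
    ext t
    change BTensor.map _ _ t = BTensor.map f'.hom LinearMap.id (BTensor.map f.hom LinearMap.id t)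
    induction t using BTensor.induction_on with
    | tmul n x => rfl
    | add x y hx hy => rw [map_add, map_add, map_add, hx, hy]
    | zero => rw [map_zero, map_zero, map_zero]

/-- The functor of invariants from firm right `C`-modules to right `B`-modules. -/
def invFunctor (g : C) :
    ARing.FirmMod.{max u w} γ.aring ⥤ ModuleCat.{max u w} (γ.baseRing g)ᵐᵒᵖ where
  obj M := ModuleCat.of (γ.baseRing g)ᵐᵒᵖ (γ.inv g M.action)
  map {M M'} f := ModuleCat.ofHom
    { toFun := fun m => ⟨f.toLinearMap m, fun c => by
        have h : f.toLinearMap _ = _ := f.map_act' (m : M.carrier) c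
        rw [m.2 c, map_smul] at h
        exact h.symm⟩
      map_add' := fun m m' => by ext; simp
      map_smul' := fun b m => by ext; simp }
  map_id M := by ext m; rfl
  map_comp f f' := by ext m; rfl

end Functors

end CoringMorita

open CategoryTheory CoringMorita

universe w' w u v

open MulOpposite
open scoped TensorProduct

namespace CoringMorita

namespace Cointegral

section

variable {A : Type*} [Ring A] {C : Type*} [AddCommGroup C] [Module A C] [Module Aᵐᵒᵖ C]
  [SMulCommClass A Aᵐᵒᵖ C] {K : Coring A C} (γ : Cointegral K) {g : C}

/-! Everything rests on `app_grouplike`: `γ(g ⊗ g) = ε(g) = 1`. The Morita map `τ`, `a ⊗ q ↦ γ(ga ⊗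
q)`, takes values in `B` (`app_mem_baseRing`), and since `g ∈ Q` it sends `1 ⊗ g` to `1`, so it is
surjective. The four claims are the usual consequences, each with explicit maps.

Putting `g` in one slot gives `B`-linear maps `A → B`, `a ↦ γ(ga ⊗ g)`, and `Q → B`, `q ↦ γ(g ⊗ q)`.
Both have `1` as a value, whence the generator claims. Both direct summand claims hold with a single
copy of `C`: `a ↦ ga` is split by `c ↦ γ(g ⊗ c)`, and `Q ⊆ C` is split by `c ↦ cg`.

For the functors, acting by `g` on `N ⊗_B A` lands in the elements `n ⊗ 1`
(`rightTensor_act_grouplike`), whereas an invariant `t` satisfies `t·g = t γ(g ⊗ g) = t`. Hence the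
unit `n ↦ n ⊗ 1` is bijective (`tensorUnit_bijective`), and a left adjoint whose unit is an
isomorphism is fully faithful. -/

/-! ### The left ideal `Q` and the values of `τ` -/

theorem grouplike_mem_idealQ (hg : K.IsGrouplike g) : g ∈ γ.idealQ g := fun c => by
  -- Because `Δ(g) = g ⊗ g`, the product `gc` is `g γ(g ⊗ c)`, which is the invariance of `g`.
  have h := γ.prod_grouplike hg 1 c
  rwa [op_one, one_smul] at h

theorem mem_idealQ_iff {q : C} :
    q ∈ γ.idealQ g ↔ ∀ c : C, γ.aring.mul q c = op (γ.app g c) • q := Iff.rfl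

/-- `Q` is a left ideal. -/
theorem mul_mem_idealQ (c : C) {q : C} (hq : q ∈ γ.idealQ g) : γ.aring.mul c q ∈ γ.idealQ g :=
  ((γ.leftQ g).act c ⟨q, hq⟩).2

/-- `g` is a right unit of `Q`. -/
theorem mul_grouplike (hg : K.IsGrouplike g) {q : C} (hq : q ∈ γ.idealQ g) :
    γ.aring.mul q g = q := by
  rw [γ.mem_idealQ_iff.1 hq g, app_grouplike γ hg, op_one, one_smul]

theorem isSubring_idealQ : γ.aring.IsSubring (γ.idealQ g : Set C) where
  zero_mem := zero_mem _
  add_mem _ hs _ ht := add_mem hs ht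
  neg_mem _ hs := neg_mem hs
  mul_mem s _ _ ht := γ.mul_mem_idealQ s ht

/-- The map `τ` of the Morita context takes values in `B`: `γ(g a ⊗ q) ∈ B` for `q ∈ Q`. -/
theorem app_mem_baseRing (hg : K.IsGrouplike g) (a : A) {q : C} (hq : q ∈ γ.idealQ g) :
    γ.app (op a • g) q ∈ γ.baseRing g := fun c => by
  -- Absorb the scalar into a product, then reassociate: `γ(g γ(ga ⊗ q) ⊗ c) = γ((ga)q ⊗ c) = γ(ga ⊗
  -- qc)`. Invariance of `q` turns this into `γ(ga ⊗ q γ(g ⊗ c)) = γ(ga ⊗ q) γ(g ⊗ c)`.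
  rw [← γ.prod_grouplike hg, app_prod, ← aring_mul, γ.mem_idealQ_iff.1 hq, app_op_smul]

/-! ### `B`-linear maps from `A` and `Q` to `B` -/

/-- Pass `a` across the tensor sign so that the definition of `B` applies, then pass it back: `γ(gba
⊗ c) = γ(gb ⊗ ac) = b γ(g ⊗ ac) = b γ(ga ⊗ c)`. -/
theorem app_baseRing_mul (b : γ.baseRing g) (a : A) (c : C) :
    γ.app (op ((b : A) * a) • g) c = b * γ.app (op a • g) c := by
  rw [op_mul, mul_smul, app_balanced, b.2, app_balanced]

/-- The left `B`-linear map `A → B`, `a ↦ γ(g a ⊗ g)`. -/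
def toBase (hg : K.IsGrouplike g) : A →ₗ[γ.baseRing g] γ.baseRing g where
  toFun a := ⟨γ.app (op a • g) g, γ.app_mem_baseRing hg a (γ.grouplike_mem_idealQ hg)⟩
  map_add' a a' := by ext; simp [add_smul, app_add_left]
  map_smul' b a := by
    ext
    exact γ.app_baseRing_mul b a g

@[simp] theorem coe_toBase (hg : K.IsGrouplike g) (a : A) :
    (γ.toBase hg a : A) = γ.app (op a • g) g := rfl

@[simp] theorem toBase_one (hg : K.IsGrouplike g) : γ.toBase hg 1 = 1 := by
  ext
  simp [app_grouplike γ hg]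

/-- The right `B`-linear map `Q → B`, `q ↦ γ(g ⊗ q)`. -/
def idealQToBase (hg : K.IsGrouplike g) : γ.idealQ g →ₗ[(γ.baseRing g)ᵐᵒᵖ] γ.baseRing g where
  toFun q := ⟨γ.app g q, by simpa using γ.app_mem_baseRing hg 1 q.2⟩
  map_add' q q' := by ext; simp [app_add_right]
  map_smul' b q := by
    ext
    exact γ.app_op_smul b.unop g q

@[simp] theorem idealQToBase_grouplike (hg : K.IsGrouplike g) :
    γ.idealQToBase hg ⟨g, γ.grouplike_mem_idealQ hg⟩ = 1 := by
  ext
  exact app_grouplike γ hg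

/-! ### Direct summands of `C` -/

/-- The inclusion is `a ↦ ga`, the projection `c ↦ γ(g ⊗ c)`, and their composite is `a ↦ γ(g ⊗ g) a
= a`. -/
theorem rightA_isDirectSummand (hg : K.IsGrouplike g) :
    (γ.rightA hg).IsDirectSummand (γ.aring.rightRegular.pow 1) := by
  -- `toSpanSingleton` starts at the scalar ring `Aᵐᵒᵖ`, so `A` is first identified with it as a
  -- right module.
  refine ⟨⟨LinearMap.pi fun _ => LinearMap.toSpanSingleton Aᵐᵒᵖ C g ∘ₗ
      (opLinearEquiv Aᵐᵒᵖ : A ≃ₗ[Aᵐᵒᵖ] Aᵐᵒᵖ).toLinearMap, fun a c => ?_⟩,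
    ⟨{ toFun := fun c => γ.app g (c 0)
       map_add' := fun c c' => γ.app_add_right g _ _
       map_smul' := fun a c => γ.app_op_smul a.unop g (c 0) }, fun m c => ?_⟩, fun a => ?_⟩
  · funext i
    exact (γ.prod_grouplike hg a c).symm
  -- The projection is `c ↦ 1·c` in the module `A`, so its `C`-linearity is associativity of the
  -- action at `1`.
  · have h := (γ.rightA hg).act_mul 1 (m 0) c
    simp only [rightA_act, op_one, one_smul] at h
    exact h.symm
  · change γ.app g (op a • g) = a
    rw [app_op_smul, app_grouplike γ hg, one_mul]

/-- The inclusion is split by `c ↦ cg`: this lands in the left ideal `Q` because `g ∈ Q`, and fixes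
`Q` because `g` is a right unit there. -/
theorem leftQ_isDirectSummand (hg : K.IsGrouplike g) :
    (γ.leftQ g).IsDirectSummand (γ.aring.leftRegular.pow 1) := by
  refine ⟨⟨{ toFun := fun q _ => q
             map_add' := fun _ _ => rfl
             map_smul' := fun _ _ => rfl }, fun _ _ => rfl⟩,
    ⟨{ toFun := fun c => ⟨γ.aring.mul (c 0) g, γ.mul_mem_idealQ _ (γ.grouplike_mem_idealQ hg)⟩
       map_add' := fun c c' => by ext; simp
       map_smul' := fun a c => by ext; exact γ.aring.smul_mul a (c 0) g }, fun s c => ?_⟩,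
    fun q => ?_⟩
  · ext
    exact γ.aring.mul_assoc s (c 0) g
  · ext
    exact γ.mul_grouplike hg q.2

/-! ### Generators -/

/-- Any `x ∈ X` is the image of `1` under `A → B → X`, where the second map is `b ↦ bx`. Maps that
agree after every `A → X` therefore agree at `x`. -/
theorem isGenerator_left (hg : K.IsGrouplike g) : IsGenerator.{w'} (γ.baseRing g) A := by
  intro X Y _ _ _ _ f f' h
  ext x
  simpa using LinearMap.congr_fun
    (h (LinearMap.toSpanSingleton (γ.baseRing g) X x ∘ₗ γ.toBase hg)) 1

/-- The same argument through `Q → B → X`, evaluated at `g`, which maps to `1 ∈ B`. -/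
theorem isGenerator_idealQ (hg : K.IsGrouplike g) :
    IsGenerator.{w'} (γ.baseRing g)ᵐᵒᵖ (γ.idealQ g) := by
  intro X Y _ _ _ _ f f' h
  ext x
  simpa using LinearMap.congr_fun
    (h (LinearMap.toSpanSingleton (γ.baseRing g)ᵐᵒᵖ X x ∘ₗ
      (opLinearEquiv (γ.baseRing g)ᵐᵒᵖ).toLinearMap ∘ₗ γ.idealQToBase hg))
    ⟨g, γ.grouplike_mem_idealQ hg⟩

/-! ### The unit `N → (N ⊗_B A)^C` -/

section Unit

variable (N : Type*) [AddCommGroup N] [Module (γ.baseRing g)ᵐᵒᵖ N]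

/-- The map `N → (N ⊗_B A)^C`, `n ↦ n ⊗ 1`. -/
def tensorUnit (hg : K.IsGrouplike g) :
    N →ₗ[(γ.baseRing g)ᵐᵒᵖ] γ.inv g (γ.rightTensor hg N) where
  toFun n := ⟨BTensor.tmul _ n 1, fun c => by
    rw [rightTensor_act, BTensor.smul_tmul_right]
    simp⟩
  map_add' n n' := by ext; exact BTensor.add_tmul n n' 1
  map_smul' b n := by
    ext
    change BTensor.tmul _ (op b.unop • n) (1 : A) = op (b.unop : A) • BTensor.tmul _ n (1 : A)
    rw [BTensor.op_smul_tmul, BTensor.smul_tmul_right]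
    simp [Subring.smul_def]

@[simp] theorem coe_tensorUnit (hg : K.IsGrouplike g) (n : N) :
    (γ.tensorUnit N hg n : BTensor (γ.baseRing g) N A) = BTensor.tmul _ n 1 := rfl

/-- The map `N ⊗_B A → N`, `n ⊗ a ↦ n γ(g a ⊗ g)`. -/
def tensorRetract (hg : K.IsGrouplike g) : BTensor (γ.baseRing g) N A →+ N :=
  BTensor.lift (AddMonoidHom.mk' (fun n => AddMonoidHom.mk' (fun a => op (γ.toBase hg a) • n)
      (fun a a' => by simp [add_smul]))
    (fun n n' => by ext a; simp))
    (fun n b a => by simp [mul_smul])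

@[simp] theorem tensorRetract_tmul (hg : K.IsGrouplike g) (n : N) (a : A) :
    γ.tensorRetract N hg (BTensor.tmul _ n a) = op (γ.toBase hg a) • n := rfl

/-- Since `γ(ga ⊗ g)` lies in `B`, it crosses the tensor sign: `(n ⊗ a)·g = n ⊗ γ(ga ⊗ g) = n γ(ga ⊗
g) ⊗ 1`. -/
theorem rightTensor_act_grouplike (hg : K.IsGrouplike g) (t : BTensor (γ.baseRing g) N A) :
    (γ.rightTensor hg N).act t g = BTensor.tmul _ (γ.tensorRetract N hg t) 1 := by
  induction t using BTensor.induction_on with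
  | tmul n a =>
    rw [rightTensor_act, tensorRetract_tmul, BTensor.op_smul_tmul]
    simp [Subring.smul_def]
  | add x y hx hy => rw [map_add, AddMonoidHom.add_apply, hx, hy, map_add, BTensor.add_tmul]
  | zero => rw [map_zero, AddMonoidHom.zero_apply, map_zero, BTensor.zero_tmul]

theorem tensorUnit_bijective (hg : K.IsGrouplike g) :
    Function.Bijective (γ.tensorUnit N hg) := by
  refine Function.bijective_iff_has_inverse.2
    ⟨fun t => γ.tensorRetract N hg t, fun n => by simp, fun t => ?_⟩
  ext
  -- An invariant `t` is recovered from its retract: `tensorRetract(t) ⊗ 1 = t·g = t γ(g ⊗ g) = t`.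
  rw [coe_tensorUnit, ← rightTensor_act_grouplike, t.2, app_grouplike γ hg, op_one, one_smul]

/-! ### Morphisms out of `N ⊗_B A` -/

variable {N} {M : Type*} [AddCommGroup M] [Module Aᵐᵒᵖ M] {α : γ.aring.RightAction M}

/-- The additive map `N ⊗_B A → M`, `n ⊗ a ↦ h(n) a`, that extends `h : N → M^C`. -/
def tensorLiftHom (h : N →ₗ[(γ.baseRing g)ᵐᵒᵖ] γ.inv g α) : BTensor (γ.baseRing g) N A →+ M :=
  BTensor.lift (AddMonoidHom.mk' (fun n => AddMonoidHom.mk'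
        (fun a : A => op a • (h n : M)) (fun a a' => by rw [MulOpposite.op_add, add_smul]))
      (fun n n' => by ext a; simp))
    (fun n b a => by
      change op a • ((h (op b • n) : γ.inv g α) : M) = op ((b : A) * a) • (h n : M)
      rw [map_smul, coe_op_smul_inv, op_mul, mul_smul, unop_op])

@[simp] theorem tensorLiftHom_tmul (h : N →ₗ[(γ.baseRing g)ᵐᵒᵖ] γ.inv g α) (n : N) (a : A) :
    γ.tensorLiftHom h (BTensor.tmul _ n a) = op a • (h n : M) := rfl

/-- The map `n ⊗ a ↦ h(n) a` is a morphism of right `C`-modules. -/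
def tensorLift (hg : K.IsGrouplike g) (h : N →ₗ[(γ.baseRing g)ᵐᵒᵖ] γ.inv g α) :
    ARing.RightAction.Hom (γ.rightTensor hg N) α where
  toFun := γ.tensorLiftHom h
  map_add' := map_add _
  map_smul' a t := by
    rw [RingHom.id_apply]
    induction t using BTensor.induction_on with
    | tmul n x => exact mul_smul a (op x) (h n : M)
    | add x y hx hy =>
      rw [smul_add, map_add, map_add, hx, hy, smul_add]
    | zero => rw [smul_zero, map_zero, smul_zero]
  map_act' t c := by
    induction t using BTensor.induction_on with
    | tmul n a =>
      -- Invariance of `h(n)` gives `C`-linearity: `(h(n)a)·c = h(n)·(ac) = h(n) γ(g ⊗ ac) = h(n)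
      -- γ(ga ⊗ c)`.
      rw [rightTensor_act, tensorLiftHom_tmul, tensorLiftHom_tmul, α.act_balanced, (h n).2,
        app_balanced]
    | add x y hx hy =>
      rw [map_add, AddMonoidHom.add_apply, map_add, hx, hy, map_add, map_add,
        AddMonoidHom.add_apply]
    | zero =>
      rw [map_zero, AddMonoidHom.zero_apply, map_zero, map_zero, AddMonoidHom.zero_apply]

/-- The elements `n ⊗ 1` generate, as `n ⊗ a = (n ⊗ 1)a`. Naturality of the counit and the left
triangle identity are reduced to them. -/
theorem rightTensor_hom_ext (hg : K.IsGrouplike g)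
    {f f' : ARing.RightAction.Hom (γ.rightTensor hg N) α}
    (h : ∀ n : N, f.toLinearMap (BTensor.tmul _ n 1) = f'.toLinearMap (BTensor.tmul _ n 1)) :
    f = f' := by
  have key : f.toLinearMap.toAddMonoidHom = f'.toLinearMap.toAddMonoidHom :=
    BTensor.hom_ext fun n a => by
      have ha : BTensor.tmul (γ.baseRing g) n a = op a • BTensor.tmul _ n (1 : A) := by
        rw [BTensor.smul_tmul_right, op_smul_eq_mul, one_mul]
      simp only [LinearMap.toAddMonoidHom_coe]
      rw [ha, map_smul, map_smul, h]
  exact ARing.RightAction.Hom.ext (funext fun t => DFunLike.congr_fun key t)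

end Unit

end

/-! ### The adjunction and full faithfulness -/

section Adjunction

variable {A : Type u} [Ring A] {C : Type v} [AddCommGroup C] [Module A C] [Module Aᵐᵒᵖ C]
  [SMulCommClass A Aᵐᵒᵖ C] {K : Coring A C} (γ : Cointegral K) {g : C}

/-- The adjunction between `- ⊗_B A` and the functor of invariants. -/
def tensorInvAdjunction (hg : K.IsGrouplike g) :
    tensorFunctor.{w} γ hg ⊣ invFunctor.{w} γ g :=
  Adjunction.mkOfUnitCounit
    { unit :=
        { app := fun N => ModuleCat.ofHom (γ.tensorUnit N hg)
          naturality := fun N N' f => by ext n; rfl }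
      counit :=
        { app := fun M => γ.tensorLift hg (LinearMap.id : γ.inv g M.action →ₗ[_] _)
          naturality := fun M M' f => by
            refine γ.rightTensor_hom_ext hg fun n => ?_
            change op (1 : A) • f.toLinearMap (n.1 : M.carrier) =
              f.toLinearMap (op (1 : A) • (n.1 : M.carrier))
            rw [map_smul] }
      left_triangle := by
        ext N
        exact γ.rightTensor_hom_ext hg fun n =>
          one_smul Aᵐᵒᵖ (BTensor.tmul (γ.baseRing g) n (1 : A))
      right_triangle := by
        ext M m
        apply Subtype.ext
        exact one_smul Aᵐᵒᵖ (m.1 : M.carrier) }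

instance isIso_tensorInvAdjunction_unit (hg : K.IsGrouplike g) :
    IsIso (γ.tensorInvAdjunction.{w} hg).unit := by
  have (N : ModuleCat.{max u w} (γ.baseRing g)ᵐᵒᵖ) :
      IsIso ((γ.tensorInvAdjunction.{w} hg).unit.app N) :=
    -- The unit of the adjunction is `tensorUnit` by definition, so its bijectivity applies
    -- directly.
    (ConcreteCategory.isIso_iff_bijective _).2 (γ.tensorUnit_bijective N hg)
  exact NatIso.isIso_of_isIso_app _

theorem fullyFaithful_tensorFunctor (hg : K.IsGrouplike g) :
    (tensorFunctor.{w} γ hg).Full ∧ (tensorFunctor.{w} γ hg).Faithful :=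
  let h := (γ.tensorInvAdjunction.{w} hg).fullyFaithfulLOfIsIsoUnit
  ⟨h.full, h.faithful⟩

end Adjunction

end Cointegral

end CoringMorita

/-- The Morita context of a coseparable coring with a grouplike element: properties that follow
from surjectivity of `τ`. -/
theorem mainTheorem6 {A : Type u} [Ring A] {C : Type v} [AddCommGroup C]
    [Module A C] [Module Aᵐᵒᵖ C] [SMulCommClass A Aᵐᵒᵖ C]
    (K : Coring A C) (γ : Cointegral K) (g : C) (hg : K.IsGrouplike g) :
    -- `Q` is a subring of `C` with right unit `g`
    (γ.aring.IsSubring (γ.idealQ g : Set C) ∧ g ∈ γ.idealQ g ∧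
      ∀ q ∈ γ.idealQ g, γ.aring.mul q g = q) ∧
    -- `- ⊗_B A` is fully faithful, and the unit `n ↦ n ⊗ 1` of the adjunction is an isomorphism
    ((tensorFunctor.{w} γ hg).Full ∧ (tensorFunctor.{w} γ hg).Faithful ∧
      ∃ adj : tensorFunctor.{w} γ hg ⊣ invFunctor.{w} γ g,
        (∀ (N : ModuleCat.{max u w} (γ.baseRing g)ᵐᵒᵖ) (n : N),
          ((adj.unit.app N).hom n : γ.inv g (γ.rightTensor hg N)).1 =
            BTensor.tmul (γ.baseRing g) n (1 : A)) ∧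
        IsIso adj.unit) ∧
    -- `A` and `Q` are direct summands of finite powers of `C` as right resp. left `C`-modules
    ((∃ n : ℕ, (γ.rightA hg).IsDirectSummand (γ.aring.rightRegular.pow n)) ∧
      ∃ n : ℕ, (γ.leftQ g).IsDirectSummand (γ.aring.leftRegular.pow n)) ∧
    -- `A` is a generator as a left, and `Q` as a right `B`-module
    IsGenerator.{w'} (γ.baseRing g) A ∧
    IsGenerator.{w'} (γ.baseRing g)ᵐᵒᵖ (γ.idealQ g) := by
  exact ⟨⟨γ.isSubring_idealQ, γ.grouplike_mem_idealQ hg, fun _ hq => γ.mul_grouplike hg hq⟩,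
    ⟨(γ.fullyFaithful_tensorFunctor.{w} hg).1, (γ.fullyFaithful_tensorFunctor.{w} hg).2,
      γ.tensorInvAdjunction.{w} hg, fun _ _ => rfl, inferInstance⟩,
    ⟨⟨1, γ.rightA_isDirectSummand hg⟩, ⟨1, γ.leftQ_isDirectSummand hg⟩⟩,
    γ.isGenerator_left hg, γ.isGenerator_idealQ hg⟩
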